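/- **Model.** Let $n,k\ge 1$ and $m\ge 0$ be integers. Each of $k$ processors holds some of $n$ input qubits, as given by a partition $\pi:\{1,\dots,n\}\to\{1,\dots,k\}$, and $m$ ancilla qubits. For a real constant $B$, $\pi$ is called *$B$-balanced* if $\bigl||\pi^{-1}(p)|-n/k\bigr|\le B$ for every processor $p$. A distributed circuit is a finite sequence of gates, each of which is either an arbitrary unitary on the qubits of one processor (free of charge), or a *nonlocal two-qubit gate*, i.e. an arbitrary unitary on two qubits that reside on two different processors (every pair of processors may be used). A circuit with overall operator $W$ implements an $n$-qubit unitary $V$ if $W(|\psi\rangle\otimes|0\cdots0\rangle)=(V|\psi\rangle)\otimes|0\cdots0\rangle$ for all $|\psi\rangle$, where the second factor is the state of all the ancilla qubits. Let $\mathcal C^{(k)}_{m,B}(V)\in\{0,1,2,\dots,\infty\}$ be the minimum number of nonlocal two-qubit gates in a circuit that implements $V$, over all $B$-balanced partitions $\pi$ and all circuits ($\infty$ if there is none), and for $\epsilon>0$ let $$\mathcal C^{(k)}_{m,B}(U;\epsilon)=\min\{\mathcal C^{(k)}_{m,B}(V): V \text{ an $n$-qubit unitary},\ \|V-U\|_2\le\epsilon\},$$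 where $\|\cdot\|_2$ is the spectral norm. **Lemma.** For every real constant $B$ there is a constant $c>0$, depending only on $B$, such that for all integers $m\ge 0$ and $2\le k\le n$ with $B<n-n/k$ (so that no $B$-balanced partition puts all the input qubits on one processor; this always holds when $n>2B$) and all $\epsilon\in[2^{-n},1/20]$, there is an $n$-qubit unitary $U$ with $$\mathcal C^{(k)}_{m,B}(U;\epsilon)\ \ge\ c\cdot\frac{4^{(1-1/k)n-m}\,\log(1/\epsilon)}{n}.$$ -/

import Mathlib

open scoped ENNReal Matrix.Norms.L2Operator

noncomputable section

/-- Operators on the Hilbert space of a register of qubits labelled by `Q`, written in the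
computational basis, whose elements are the bit assignments `Q → Fin 2`. The norm on operators is
the spectral norm (the operator norm with respect to the Euclidean norm). -/
abbrev QOp (Q : Type) : Type := Matrix (Q → Fin 2) (Q → Fin 2) ℂ

/-- The unitary operators on a register. -/
abbrev qUnitary (Q : Type) [Fintype Q] [DecidableEq Q] : Submonoid (QOp Q) :=
  Matrix.unitaryGroup (Q → Fin 2) ℂ

/-- The operator on the whole register which applies `M` to the qubits in `S` and the identity to
all the other qubits. -/
def applyOn {Q : Type} [Fintype Q] [DecidableEq Q] (S : Finset Q)
    (M : QOp {q // q ∈ S}) : QOp Q :=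
  fun x y => if ∀ q, q ∉ S → x q = y q then M (fun q => x q.1) (fun q => y q.1) else 0

/-- `CircuitOp G owner ℓ W`: the operator `W` is the product of the gates of a distributed quantum
circuit with exactly `ℓ` nonlocal two-qubit gates. Qubit `q` resides on processor `owner q`.
A processor may apply any unitary to its own qubits at no cost; a nonlocal gate is an arbitrary
unitary on two qubits which reside on two processors adjacent in the topology `G`. -/
inductive CircuitOp {Q : Type} [Fintype Q] [DecidableEq Q] {k : ℕ} (G : SimpleGraph (Fin k))
    (owner : Q → Fin k) : ℕ → QOp Q → Prop
  | empty : CircuitOp G owner 0 1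
  | localGate {ℓ : ℕ} {W : QOp Q} (p : Fin k)
      (M : QOp {q // q ∈ Finset.univ.filter (fun q => owner q = p)}) (hM : M ∈ qUnitary _)
      (hW : CircuitOp G owner ℓ W) :
      CircuitOp G owner ℓ (applyOn (Finset.univ.filter (fun q => owner q = p)) M * W)
  | nonlocalGate {ℓ : ℕ} {W : QOp Q} (a b : Q) (hab : G.Adj (owner a) (owner b))
      (M : QOp {q // q ∈ ({a, b} : Finset Q)}) (hM : M ∈ qUnitary _)
      (hW : CircuitOp G owner ℓ W) :
      CircuitOp G owner (ℓ + 1) (applyOn {a, b} M * W)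

/-- The qubits of a system with `n` input qubits and `k` processors with `m` ancilla qubits each. -/
abbrev Qubit (n k m : ℕ) : Type := Fin n ⊕ (Fin k × Fin m)

/-- The processor on which a qubit resides, when the `i`-th input qubit is on processor `π i`. -/
def ownerOf {n k m : ℕ} (π : Fin n → Fin k) : Qubit n k m → Fin k :=
  Sum.elim π Prod.fst

/-- The vector `ψ ⊗ |0…0⟩`, with all the ancilla qubits in the state `|0⟩`. -/
def withAncillas {n k m : ℕ} (ψ : (Fin n → Fin 2) → ℂ) : (Qubit n k m → Fin 2) → ℂ :=
  fun z => if ∀ a, z (Sum.inr a) = 0 then ψ (fun i => z (Sum.inl i)) else 0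

/-- `W` implements `V` with clean ancillas: `W (ψ ⊗ |0…0⟩) = (V ψ) ⊗ |0…0⟩` for every `ψ`. -/
def Implements {n k m : ℕ} (W : QOp (Qubit n k m)) (V : QOp (Fin n)) : Prop :=
  ∀ ψ : (Fin n → Fin 2) → ℂ,
    Matrix.mulVec W (withAncillas ψ) = withAncillas (Matrix.mulVec V ψ)

/-- A partition of the input qubits is balanced, with constant `B`, if every processor holds
`n / k` input qubits up to an additive error of at most `B`. -/
def IsBalanced {n k : ℕ} (B : ℝ) (π : Fin n → Fin k) : Prop :=
  ∀ p : Fin k,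
    |((Finset.univ.filter (fun i => π i = p)).card : ℝ) - (n : ℝ) / (k : ℝ)| ≤ B

/-- The minimum number of nonlocal two-qubit gates needed to implement `V` for a given partition
`π` of the input qubits (`⊤` if `V` cannot be implemented). -/
def commCostGiven {n k : ℕ} (m : ℕ) (G : SimpleGraph (Fin k)) (π : Fin n → Fin k)
    (V : QOp (Fin n)) : ℕ∞ :=
  ⨅ (ℓ : ℕ) (_ : ∃ W : QOp (Qubit n k m), CircuitOp G (ownerOf π) ℓ W ∧ Implements W V), (ℓ : ℕ∞)

/-- Communication complexity of `V` over the topology `G`: the minimum over all balanced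
partitions. -/
def commComplexity {n k : ℕ} (B : ℝ) (m : ℕ) (G : SimpleGraph (Fin k)) (V : QOp (Fin n)) : ℕ∞ :=
  ⨅ (π : Fin n → Fin k) (_ : IsBalanced B π), commCostGiven m G π V

/-- Approximate communication complexity over the topology `G`: the minimum over all unitaries
within spectral norm distance `ε`. -/
def approxCommComplexity {n k : ℕ} (B : ℝ) (m : ℕ) (G : SimpleGraph (Fin k)) (U : QOp (Fin n))
    (ε : ℝ) : ℕ∞ :=
  ⨅ (V : QOp (Fin n)) (_ : V ∈ qUnitary (Fin n)) (_ : ‖V - U‖ ≤ ε), commComplexity B m G V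

/-- Approximate `k`-party communication complexity: every pair of processors is connected. -/
def approxPartyComplexity {n : ℕ} (B : ℝ) (m k : ℕ) (U : QOp (Fin n)) (ε : ℝ) : ℕ∞ :=
  approxCommComplexity B m (⊤ : SimpleGraph (Fin k)) U ε

end

/-!
The proof compares how many sets of small diameter are needed to cover two sets of operators
(`DiamCover`), and treats separately the case where the claimed bound is only of the order of the
number `k` of processors. Write `X = 4 ^ ((1 - 1 / k) * n - m) * log (1 / ε) / n`.

If `X` is large compared with `k`, a counting argument applies. Local unitaries can be moved past
all gates that do not touch their processor, so a circuit with `l` nonlocal gates is a product of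
only `k + 3 * l` unitaries on about `n / k + m` qubits each (`CircuitOp.exists_normalForm`).
Rounding their entries to a grid covers all `n`-qubit unitaries implemented with at most `L`
nonlocal gates by `2 ^ O(n * 4 ^ (n / k + m) * (k + L) + n ^ 2)` sets of diameter `ε`
(`diamCover_cheap`). If every unitary were within `ε` of one of these, the unitary group would be
covered by the same number of sets of diameter `3 * ε`. But every self-adjoint contraction `H` is
the real part of the unitary `H + i √(1 - H ^ 2)`, so the unitary group is at least as hard to
cover as the unit ball of a real vector space of dimension `4 ^ n`, which by volume takes at least
`(1 / (3 * ε)) ^ (4 ^ n)` sets (`DiamCover.one_le_of_unitaryGroup`). For `L` of the order of `X`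
this is a contradiction (`card_parts_mul_lt_one`).

If `X` is at most a constant times `k`, the diagonal unitary `weightTwoPhase`, which is far from
every tensor product, serves for all balanced partitions: the nonlocal gates have to connect all
the processors that hold input qubits, of which there are at least two and at least a constant
times `k` (`card_occupied_le_of_near_weightTwoPhase`, `IsBalanced.card_occupied`).
-/

/-! ### Covers by sets of small diameter -/

/-- `A` is covered by `N` sets, each of diameter at most `δ`. The parts need not be balls, be
disjoint, or be contained in `A`. -/
def DiamCover {E : Type*} [PseudoMetricSpace E] (A : Set E) (N : ℕ) (δ : ℝ) : Prop :=
  ∃ P : Fin N → Set E, (∀ x ∈ A, ∃ i, x ∈ P i) ∧ ∀ i, ∀ x ∈ P i, ∀ y ∈ P i, dist x y ≤ δ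

namespace DiamCover

variable {E F : Type*} [PseudoMetricSpace E] [PseudoMetricSpace F]

theorem of_fintype {ι : Type*} [Fintype ι] {A : Set E} {δ : ℝ} (P : ι → Set E)
    (hA : ∀ x ∈ A, ∃ i, x ∈ P i) (hP : ∀ i, ∀ x ∈ P i, ∀ y ∈ P i, dist x y ≤ δ) :
    DiamCover A (Fintype.card ι) δ := by
  refine ⟨fun j => P ((Fintype.equivFin ι).symm j), fun x hx => ?_, fun j => hP _⟩
  obtain ⟨i, hi⟩ := hA x hx
  exact ⟨Fintype.equivFin ι i, by simpa using hi⟩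

theorem mono {A B : Set E} {N N' : ℕ} {δ δ' : ℝ} (h : DiamCover B N δ) (hAB : A ⊆ B)
    (hN : N ≤ N') (hδ : δ ≤ δ') : DiamCover A N' δ' := by
  obtain ⟨P, hA, hP⟩ := h
  refine ⟨fun j => {x | ∃ h : j.1 < N, x ∈ P ⟨j, h⟩}, fun x hx => ?_, ?_⟩
  · obtain ⟨i, hi⟩ := hA x (hAB hx)
    exact ⟨⟨i, i.2.trans_le hN⟩, i.2, hi⟩
  · rintro j x ⟨h, hx⟩ y ⟨_, hy⟩
    exact (hP _ x hx y hy).trans hδ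

theorem singleton (x : E) : DiamCover {x} 1 0 :=
  ⟨fun _ => {x}, fun _ hy => ⟨0, hy⟩, by rintro _ y rfl z hz; simp [Set.mem_singleton_iff.1 hz]⟩

theorem image {A : Set E} {N : ℕ} {δ : ℝ} (h : DiamCover A N δ) (f : E → F)
    (hf : ∀ x y, dist (f x) (f y) ≤ dist x y) : DiamCover (f '' A) N δ := by
  obtain ⟨P, hA, hP⟩ := h
  refine ⟨fun i => f '' P i, ?_, ?_⟩
  · rintro _ ⟨x, hx, rfl⟩
    obtain ⟨i, hi⟩ := hA x hx
    exact ⟨i, x, hi, rfl⟩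
  · rintro i _ ⟨x, hx, rfl⟩ _ ⟨y, hy, rfl⟩
    exact (hf x y).trans (hP i x hx y hy)

theorem iUnion {ι : Type*} [Fintype ι] {A : ι → Set E} {N : ℕ} {δ : ℝ}
    (h : ∀ i, DiamCover (A i) N δ) : DiamCover (⋃ i, A i) (Fintype.card ι * N) δ := by
  choose P hA hP using h
  have := of_fintype (ι := ι × Fin N) (A := ⋃ i, A i) (δ := δ) (fun i => P i.1 i.2) ?_ ?_
  · simpa using this
  · intro x hx
    obtain ⟨i, hi⟩ := Set.mem_iUnion.1 hx
    obtain ⟨j, hj⟩ := hA i x hi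
    exact ⟨(i, j), hj⟩
  · exact fun i => hP _ _

/-- Thickening: points that are `ε`-close to a covered set are covered with diameter larger
by `2 * ε`. -/
theorem thickening {A B : Set E} {N : ℕ} {δ ε : ℝ} (h : DiamCover A N δ)
    (hB : ∀ x ∈ B, ∃ y ∈ A, dist x y ≤ ε) : DiamCover B N (δ + 2 * ε) := by
  obtain ⟨P, hA, hP⟩ := h
  refine ⟨fun i => {x | ∃ y ∈ P i, dist x y ≤ ε}, fun x hx => ?_, ?_⟩
  · obtain ⟨y, hy, hxy⟩ := hB x hx
    obtain ⟨i, hi⟩ := hA y hy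
    exact ⟨i, y, hi, hxy⟩
  · rintro i x ⟨x', hx', hx⟩ y ⟨y', hy', hy⟩
    have := hP i x' hx' y' hy'
    have h1 := dist_triangle4 x x' y' y
    rw [dist_comm y' y] at h1
    linarith

/-- Products of covered sets of contractions: the numbers of parts multiply, the diameters add. -/
theorem mul {R : Type*} [NormedRing R] {A B : Set R} {N M : ℕ} {δ η : ℝ}
    (hA : DiamCover A N δ) (hB : DiamCover B M η) (hA1 : ∀ x ∈ A, ‖x‖ ≤ 1)
    (hB1 : ∀ x ∈ B, ‖x‖ ≤ 1) : DiamCover (Set.image2 (· * ·) A B) (N * M) (δ + η) := by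
  obtain ⟨P, hA, hP⟩ := hA
  obtain ⟨Q, hB, hQ⟩ := hB
  have := of_fintype (ι := Fin N × Fin M) (A := Set.image2 (· * ·) A B) (δ := δ + η)
    (fun i => Set.image2 (· * ·) (A ∩ P i.1) (B ∩ Q i.2)) ?_ ?_
  · simpa using this
  · rintro _ ⟨x, hx, y, hy, rfl⟩
    obtain ⟨i, hi⟩ := hA x hx
    obtain ⟨j, hj⟩ := hB y hy
    exact ⟨(i, j), x, ⟨hx, hi⟩, y, ⟨hy, hj⟩, rfl⟩
  · rintro ⟨i, j⟩ _ ⟨x, ⟨hx, hxi⟩, y, ⟨hy, hyj⟩, rfl⟩ _ ⟨x', ⟨hx', hxi'⟩, y', ⟨hy', hyj'⟩, rfl⟩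
    have h1 := hP i x hxi x' hxi'
    have h2 := hQ j y hyj y' hyj'
    rw [dist_eq_norm] at h1 h2
    have e : x * y - x' * y' = (x - x') * y + x' * (y - y') := by noncomm_ring
    rw [dist_eq_norm]
    show ‖x * y - x' * y'‖ ≤ _
    rw [e]
    calc ‖(x - x') * y + x' * (y - y')‖ ≤ ‖x - x'‖ * ‖y‖ + ‖x'‖ * ‖y - y'‖ :=
          (norm_add_le _ _).trans (add_le_add (norm_mul_le _ _) (norm_mul_le _ _))
      _ ≤ ‖x - x'‖ * 1 + 1 * ‖y - y'‖ := by
          gcongr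
          · exact hB1 y hy
          · exact hA1 x' hx'
      _ ≤ δ + η := by linarith

open MeasureTheory in
/-- The volumetric lower bound: a set of diameter at most `r` lies in a ball of radius `r`, whose
volume is `r ^ dim` times that of the unit ball. -/
theorem one_le_of_closedBall {E : Type*} [NormedAddCommGroup E] [NormedSpace ℝ E]
    [FiniteDimensional ℝ E] {N : ℕ} {r : ℝ} (hr : 0 ≤ r)
    (h : DiamCover (Metric.closedBall (0 : E) 1) N r) :
    1 ≤ (N : ℝ) * r ^ Module.finrank ℝ E := by
  obtain ⟨P, hA, hP⟩ := h
  borelize E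
  let μ : Measure E := Measure.addHaar
  have hpart : ∀ i, μ (P i) ≤
      ENNReal.ofReal (r ^ Module.finrank ℝ E) * μ (Metric.closedBall 0 1) := by
    intro i
    rcases (P i).eq_empty_or_nonempty with h0 | ⟨x, hx⟩
    · simp [h0]
    · rw [← Measure.addHaar_closedBall' μ x hr]
      exact measure_mono fun y hy => hP i y hy x hx
  have hle : μ (Metric.closedBall 0 1) ≤
      (ENNReal.ofReal ((N : ℝ) * r ^ Module.finrank ℝ E)) * μ (Metric.closedBall 0 1) := by
    calc μ (Metric.closedBall 0 1) ≤ μ (⋃ i, P i) :=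
          measure_mono fun x hx => Set.mem_iUnion.2 (hA x hx)
      _ ≤ ∑ i, μ (P i) := measure_iUnion_fintype_le _ _
      _ ≤ ∑ _i : Fin N, ENNReal.ofReal (r ^ Module.finrank ℝ E) * μ (Metric.closedBall 0 1) :=
          Finset.sum_le_sum fun i _ => hpart i
      _ = _ := by
          rw [Finset.sum_const, Finset.card_univ, Fintype.card_fin, nsmul_eq_mul,
            ENNReal.ofReal_mul (by positivity), ENNReal.ofReal_natCast, mul_assoc]
  have hpos : μ (Metric.closedBall 0 1) ≠ 0 :=
    (Metric.measure_closedBall_pos μ 0 one_pos).ne'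
  have hfin : μ (Metric.closedBall 0 1) ≠ ⊤ := measure_closedBall_lt_top.ne
  by_contra hlt
  push Not at hlt
  have : ENNReal.ofReal ((N : ℝ) * r ^ Module.finrank ℝ E) < 1 := by
    rw [← ENNReal.ofReal_one]
    exact (ENNReal.ofReal_lt_ofReal_iff one_pos).2 hlt
  have h2 := ENNReal.mul_lt_mul_left hpos hfin this
  rw [one_mul] at h2
  exact absurd hle (not_le.2 h2)

end DiamCover

/-! ### The unitary group: an entropy lower bound and an entropy upper bound -/

section Matrices

variable {n : Type*} [Fintype n] [DecidableEq n]

instance finiteDimensional_selfAdjoint_matrix :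
    FiniteDimensional ℝ (selfAdjoint (Matrix n n ℂ)) :=
  inferInstanceAs (FiniteDimensional ℝ (selfAdjoint.submodule ℝ (Matrix n n ℂ)))

theorem card_sq_le_finrank_selfAdjoint :
    Fintype.card n ^ 2 ≤ Module.finrank ℝ (selfAdjoint (Matrix n n ℂ)) := by
  let f : Matrix n n ℂ →ₗ[ℝ] selfAdjoint (Matrix n n ℂ) × selfAdjoint (Matrix n n ℂ) :=
    realPart.prod imaginaryPart
  have hf : Function.Injective f := by
    intro x y hxy
    have h1 : realPart x = realPart y := congrArg Prod.fst hxy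
    have h2 : imaginaryPart x = imaginaryPart y := congrArg Prod.snd hxy
    rw [← realPart_add_I_smul_imaginaryPart x, ← realPart_add_I_smul_imaginaryPart y, h1, h2]
  have := LinearMap.finrank_le_finrank_of_injective hf
  rw [Module.finrank_prod] at this
  have h3 : Module.finrank ℝ (Matrix n n ℂ) = Fintype.card n * Fintype.card n * 2 := by
    rw [Module.finrank_matrix, Complex.finrank_real_complex]
  rw [h3] at this
  nlinarith

open scoped MatrixOrder ComplexStarModule in
/-- Every self-adjoint contraction is the real part of a unitary and taking real parts is
contractive, so the unitary group is at least as hard to cover as the unit ball of the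
self-adjoint matrices. -/
theorem DiamCover.one_le_of_unitaryGroup {N : ℕ} {r : ℝ} (hr : 0 ≤ r) (hr1 : r ≤ 1)
    (h : DiamCover (Matrix.unitaryGroup n ℂ : Set (Matrix n n ℂ)) N r) :
    1 ≤ (N : ℝ) * r ^ (Fintype.card n ^ 2) := by
  have h1 : DiamCover (Metric.closedBall (0 : selfAdjoint (Matrix n n ℂ)) 1) N r := by
    refine (h.image (fun M => (ℜ M : selfAdjoint (Matrix n n ℂ))) ?_).mono ?_ le_rfl le_rfl
    · intro x y
      rw [dist_eq_norm, dist_eq_norm, ← map_sub]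
      exact realPart.norm_le _
    · intro H hH
      have hH1 : ‖H‖ ≤ 1 := by simpa using hH
      exact ⟨selfAdjoint.unitarySelfAddISMul H hH1, (selfAdjoint.unitarySelfAddISMul H hH1).2,
        selfAdjoint.realPart_unitarySelfAddISMul H hH1⟩
  refine (DiamCover.one_le_of_closedBall hr h1).trans ?_
  exact mul_le_mul_of_nonneg_left
    (pow_le_pow_of_le_one hr hr1 card_sq_le_finrank_selfAdjoint) (by positivity)

theorem Matrix.l2_opNorm_single_le (i j : n) (c : ℂ) : ‖Matrix.single i j c‖ ≤ ‖c‖ := by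
  have h := Matrix.l2_opNorm_conjTranspose_mul_self (Matrix.single i j c)
  rw [Matrix.conjTranspose_single, Matrix.single_mul_single_same, ← Matrix.diagonal_single,
    Matrix.l2_opNorm_diagonal, Pi.norm_single, norm_mul, norm_star] at h
  nlinarith [norm_nonneg c, norm_nonneg (Matrix.single i j c)]

theorem Matrix.l2_opNorm_le_card_sq_mul {M : Matrix n n ℂ} {t : ℝ} (h : ∀ i j, ‖M i j‖ ≤ t) :
    ‖M‖ ≤ (Fintype.card n : ℝ) ^ 2 * t := by
  rw [Matrix.matrix_eq_sum_single M]
  calc _ ≤ ∑ i : n, ∑ j : n, t := norm_sum_le_of_le _ fun i _ => norm_sum_le_of_le _ fun j _ =>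
        (Matrix.l2_opNorm_single_le i j _).trans (h i j)
    _ = _ := by simp; ring

theorem Matrix.norm_entry_le_l2_opNorm (M : Matrix n n ℂ) (i j : n) : ‖M i j‖ ≤ ‖M‖ := by
  have h := Matrix.l2_opNorm_mulVec M (EuclideanSpace.single j (1 : ℂ))
  rw [PiLp.norm_single, norm_one, mul_one] at h
  refine le_trans ?_ h
  refine le_trans (le_of_eq ?_) (PiLp.norm_apply_le _ i)
  simp

/-- Rounding every entry to a grid of mesh `1 / K` covers the unitary group. -/
theorem diamCover_unitaryGroup (K : ℕ) (hK : 0 < K) :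
    DiamCover (Matrix.unitaryGroup n ℂ : Set (Matrix n n ℂ))
      ((2 * K + 1) ^ (2 * Fintype.card n ^ 2)) ((Fintype.card n : ℝ) ^ 2 * (2 / K)) := by
  have hK' : (0 : ℝ) < K := by exact_mod_cast hK
  have hfl : ∀ t : ℝ, |t| ≤ 1 → ⌊K * t⌋ ∈ Finset.Icc (-K : ℤ) K := by
    intro t ht
    rw [abs_le] at ht
    rw [Finset.mem_Icc]
    constructor
    · rw [Int.le_floor]; push_cast; nlinarith
    · rw [← Int.cast_le (R := ℝ)]
      refine (Int.floor_le _).trans ?_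
      push_cast; nlinarith
  have hclose : ∀ s t : ℝ, ⌊K * s⌋ = ⌊K * t⌋ → |s - t| ≤ 1 / K := by
    intro s t h
    have := Int.abs_sub_lt_one_of_floor_eq_floor h
    rw [← mul_sub, abs_mul, abs_of_pos hK'] at this
    rw [le_div_iff₀ hK']; linarith
  let I := Finset.Icc (-K : ℤ) K
  have := DiamCover.of_fintype (ι := n → n → I × I)
    (A := (Matrix.unitaryGroup n ℂ : Set (Matrix n n ℂ)))
    (δ := (Fintype.card n : ℝ) ^ 2 * (2 / K))
    (fun c => {M | ∀ i j, ⌊K * (M i j).re⌋ = (c i j).1.1 ∧ ⌊K * (M i j).im⌋ = (c i j).2.1}) ?_ ?_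
  · refine this.mono subset_rfl ?_ le_rfl
    simp only [Fintype.card_pi, Fintype.card_prod, Fintype.card_coe, I, Int.card_Icc,
      Finset.prod_const, Finset.card_univ]
    have h1 : ((K : ℤ) + 1 - -K).toNat = 2 * K + 1 := by omega
    rw [h1, ← sq, ← pow_mul, ← pow_mul]
    exact le_of_eq (by congr 1; ring)
  · intro M hM
    have hb : ∀ i j, ‖M i j‖ ≤ 1 := fun i j => entry_norm_bound_of_unitary hM i j
    exact ⟨fun i j => (⟨_, hfl _ ((Complex.abs_re_le_norm _).trans (hb i j))⟩,
      ⟨_, hfl _ ((Complex.abs_im_le_norm _).trans (hb i j))⟩), fun i j => ⟨rfl, rfl⟩⟩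
  · intro c M hM M' hM'
    rw [dist_eq_norm]
    refine Matrix.l2_opNorm_le_card_sq_mul fun i j => ?_
    have h1 := hclose _ _ ((hM i j).1.trans (hM' i j).1.symm)
    have h2 := hclose _ _ ((hM i j).2.trans (hM' i j).2.symm)
    refine (Complex.norm_le_abs_re_add_abs_im _).trans ?_
    rw [Matrix.sub_apply, Complex.sub_re, Complex.sub_im]
    have : (2 : ℝ) / K = 1 / K + 1 / K := by ring
    linarith

theorem norm_le_one_of_mem_unitaryGroup {M : Matrix n n ℂ} (hM : M ∈ Matrix.unitaryGroup n ℂ) :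
    ‖M‖ ≤ 1 := by
  have h := Matrix.l2_opNorm_conjTranspose_mul_self M
  rw [← Matrix.star_eq_conjTranspose, Matrix.mem_unitaryGroup_iff'.1 hM] at h
  have h1 : ‖(1 : Matrix n n ℂ)‖ ≤ 1 := by
    rw [← Matrix.diagonal_one, Matrix.l2_opNorm_diagonal]
    exact (pi_norm_le_iff_of_nonneg zero_le_one).2 fun _ => by simp
  nlinarith [norm_nonneg M]

end Matrices

namespace DiamCover

open scoped Pointwise

theorem pow {R : Type*} [NormedRing R] [NormOneClass R] {A : Set R} {N : ℕ} {δ : ℝ}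
    (hA : DiamCover A N δ) (hA1 : ∀ x ∈ A, ‖x‖ ≤ 1) (l : ℕ) :
    DiamCover (A ^ l) (N ^ l) (l * δ) ∧ ∀ x ∈ A ^ l, ‖x‖ ≤ 1 := by
  induction l with
  | zero =>
    refine ⟨?_, ?_⟩
    · simpa [← Set.singleton_one] using DiamCover.singleton (1 : R)
    · simp
  | succ l ih =>
    refine ⟨?_, ?_⟩
    · have := ih.1.mul hA ih.2 hA1
      rw [pow_succ, pow_succ]
      refine this.mono subset_rfl le_rfl ?_
      push_cast; linarith
    · rw [pow_succ]
      rintro _ ⟨x, hx, y, hy, rfl⟩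
      exact (norm_mul_le _ _).trans (mul_le_one₀ (ih.2 x hx) (norm_nonneg _) (hA1 y hy))

theorem list_prod {R ι : Type*} [NormedRing R] [NormOneClass R] {A : ι → Set R} {N : ℕ} {δ : ℝ}
    (hA : ∀ i, DiamCover (A i) N δ) (hA1 : ∀ i, ∀ x ∈ A i, ‖x‖ ≤ 1) (l : List ι) :
    DiamCover (l.map A).prod (N ^ l.length) (l.length * δ) ∧ ∀ x ∈ (l.map A).prod, ‖x‖ ≤ 1 := by
  induction l with
  | nil =>
    refine ⟨?_, ?_⟩
    · simpa [← Set.singleton_one] using DiamCover.singleton (1 : R)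
    · simp
  | cons i l ih =>
    rw [List.map_cons, List.prod_cons, List.length_cons]
    refine ⟨?_, ?_⟩
    · have := (hA i).mul ih.1 (hA1 i) ih.2
      rw [pow_succ']
      refine this.mono subset_rfl le_rfl ?_
      push_cast; linarith
    · rintro _ ⟨x, hx, y, hy, rfl⟩
      exact (norm_mul_le _ _).trans (mul_le_one₀ (hA1 i x hx) (norm_nonneg _) (ih.2 y hy))

end DiamCover

/-! ### Gates as operators on the whole register -/

section Gates

variable {Q : Type} [Fintype Q] [DecidableEq Q]

open scoped Kronecker in
theorem applyOn_eq_submatrix (S : Finset Q) (M : QOp {q // q ∈ S}) :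
    applyOn S M = (M ⊗ₖ (1 : Matrix ({q // ¬ q ∈ S} → Fin 2) _ ℂ)).submatrix
      (Equiv.piEquivPiSubtypeProd (· ∈ S) (fun _ => Fin 2))
      (Equiv.piEquivPiSubtypeProd (· ∈ S) (fun _ => Fin 2)) := by
  ext x y
  simp only [applyOn, Matrix.submatrix_apply, Matrix.kroneckerMap_apply, Matrix.one_apply,
    Equiv.piEquivPiSubtypeProd_apply, funext_iff, Subtype.forall, mul_ite, mul_one, mul_zero]

theorem applyOn_mul (S : Finset Q) (M N : QOp {q // q ∈ S}) :
    applyOn S (M * N) = applyOn S M * applyOn S N := by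
  simp only [applyOn_eq_submatrix, Matrix.submatrix_mul_equiv, ← Matrix.mul_kronecker_mul, mul_one]

theorem applyOn_one (S : Finset Q) : applyOn S (1 : QOp {q // q ∈ S}) = 1 := by
  simp only [applyOn_eq_submatrix, Matrix.one_kronecker_one, Matrix.submatrix_one_equiv]

/-- `applyOn S` as a homomorphism of star algebras; as such it is contractive and preserves
unitaries. -/
def applyOnHom (S : Finset Q) : QOp {q // q ∈ S} →⋆ₐ[ℂ] QOp Q where
  toFun := applyOn S
  map_one' := applyOn_one S
  map_mul' := applyOn_mul S
  map_zero' := by ext x y; simp [applyOn]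
  map_add' M N := by
    ext x y
    simp only [applyOn, Matrix.add_apply]
    split_ifs <;> simp
  commutes' c := by
    rw [Algebra.algebraMap_eq_smul_one, Algebra.algebraMap_eq_smul_one, ← applyOn_one S]
    ext x y
    simp only [applyOn, Matrix.smul_apply]
    split_ifs <;> simp
  map_star' M := by
    ext x y
    simp only [applyOn, Matrix.star_apply, eq_comm]
    split_ifs <;> simp

@[simp] theorem applyOnHom_apply (S : Finset Q) (M : QOp {q // q ∈ S}) :
    applyOnHom S M = applyOn S M := rfl

theorem applyOn_mul_applyOn_of_disjoint {S T : Finset Q} (h : Disjoint S T)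
    (M : QOp {q // q ∈ S}) (N : QOp {q // q ∈ T}) (x y : Q → Fin 2) :
    (applyOn S M * applyOn T N) x y = if ∀ q, q ∉ S → q ∉ T → x q = y q then
      M (fun q => x q.1) (fun q => y q.1) * N (fun q => x q.1) (fun q => y q.1) else 0 := by
  -- The only intermediate bit string that contributes agrees with `y` on `S` and with `x` off `S`.
  rw [Matrix.mul_apply, Finset.sum_eq_single (fun q => if q ∈ S then y q else x q)]
  · have h1 : ∀ q, q ∉ S → x q = if q ∈ S then y q else x q := fun q hq => by simp [hq]
    have h2 : (∀ q, q ∉ T → (if q ∈ S then y q else x q) = y q) ↔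
        ∀ q, q ∉ S → q ∉ T → x q = y q := by
      constructor
      · intro H q hS hT
        simpa [hS] using H q hT
      · intro H q hT
        by_cases hS : q ∈ S
        · simp [hS]
        · simpa [hS] using H q hS hT
    have h3 : (fun q : {q // q ∈ S} => if q.1 ∈ S then y q.1 else x q.1) = fun q => y q.1 := by
      ext q; simp [q.2]
    have h4 : (fun q : {q // q ∈ T} => if q.1 ∈ S then y q.1 else x q.1) = fun q => x q.1 := by
      ext q; simp [Finset.disjoint_right.1 h q.2]
    simp only [applyOn]
    rw [if_pos h1, h3, h4]
    by_cases hc : ∀ q, q ∉ S → q ∉ T → x q = y q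
    · rw [if_pos hc, if_pos (h2.2 hc)]
    · rw [if_neg hc, if_neg (fun H => hc (h2.1 H)), mul_zero]
  · intro z _ hz
    simp only [applyOn]
    split_ifs with h1 h2
    · refine absurd (funext fun q => ?_) hz
      by_cases hS : q ∈ S
      · simpa [hS] using h2 q (Finset.disjoint_left.1 h hS)
      · simpa [hS] using (h1 q hS).symm
    all_goals simp
  · simp

theorem commute_applyOn_of_disjoint {S T : Finset Q} (h : Disjoint S T)
    (M : QOp {q // q ∈ S}) (N : QOp {q // q ∈ T}) : Commute (applyOn S M) (applyOn T N) := by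
  ext x y
  rw [applyOn_mul_applyOn_of_disjoint h, applyOn_mul_applyOn_of_disjoint h.symm]
  have : (∀ q, q ∉ S → q ∉ T → x q = y q) ↔ (∀ q, q ∉ T → q ∉ S → x q = y q) :=
    forall_congr' fun q => forall_comm
  simp only [this, mul_comm]

/-- The unitaries that act on the qubits in `S` only. -/
def gateSet (S : Finset Q) : Set (QOp Q) := applyOn S '' (qUnitary {q // q ∈ S} : Set (QOp _))

theorem norm_applyOn_le (S : Finset Q) (M : QOp {q // q ∈ S}) : ‖applyOn S M‖ ≤ ‖M‖ :=
  NonUnitalStarAlgHom.norm_apply_le (applyOnHom S) M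

theorem norm_le_one_of_mem_gateSet {S : Finset Q} {x : QOp Q} (hx : x ∈ gateSet S) : ‖x‖ ≤ 1 := by
  obtain ⟨M, hM, rfl⟩ := hx
  exact (norm_applyOn_le S M).trans (norm_le_one_of_mem_unitaryGroup hM)

theorem diamCover_gateSet (S : Finset Q) {s : ℕ} (hS : S.card ≤ s) {K : ℕ} (hK : 0 < K) :
    DiamCover (gateSet S) ((2 * K + 1) ^ (2 * 4 ^ s)) (4 ^ s * (2 / K)) := by
  have hc : Fintype.card ({q // q ∈ S} → Fin 2) ^ 2 = 4 ^ S.card := by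
    rw [Fintype.card_fun, Fintype.card_fin, Fintype.card_coe, ← pow_mul, mul_comm, pow_mul]
    norm_num
  refine ((diamCover_unitaryGroup (n := {q // q ∈ S} → Fin 2) K hK).image (applyOn S) ?_).mono
    subset_rfl ?_ ?_
  · intro M N
    rw [dist_eq_norm, dist_eq_norm]
    have := norm_applyOn_le S (M - N)
    rwa [← applyOnHom_apply, map_sub] at this
  · rw [hc]
    exact pow_le_pow_right₀ (by omega) (Nat.mul_le_mul_left _ (Nat.pow_le_pow_right (by omega) hS))
  · have hc' : ((Fintype.card ({q // q ∈ S} → Fin 2) : ℝ)) ^ 2 = 4 ^ S.card := by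
      exact_mod_cast hc
    rw [hc']
    exact mul_le_mul_of_nonneg_right (pow_le_pow_right₀ (by norm_num) hS) (by positivity)

end Gates

/-! ### A normal form for distributed circuits -/

section NormalForm

/-- The qubits of processor `p`. -/
abbrev block {Q : Type} [Fintype Q] {k : ℕ} (owner : Q → Fin k) (p : Fin k) : Finset Q :=
  Finset.univ.filter (fun q => owner q = p)

theorem disjoint_block {Q : Type} [Fintype Q] {k : ℕ} (owner : Q → Fin k) {p p' : Fin k}
    (h : p ≠ p') : Disjoint (block owner p) (block owner p') := by
  rw [Finset.disjoint_left]
  intro q hq hq'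
  simp only [block, Finset.mem_filter, Finset.mem_univ, true_and] at hq hq'
  exact h (hq.symm.trans hq')

variable {Q : Type} [Fintype Q] [DecidableEq Q] {k : ℕ}

/-- The operators on processor `p`, as operators on the register. -/
def blockHom (owner : Q → Fin k) (p : Fin k) : QOp {q // q ∈ block owner p} →* QOp Q where
  toFun := applyOn (block owner p)
  map_one' := applyOn_one _
  map_mul' := applyOn_mul _

theorem pairwise_commute_blockHom (owner : Q → Fin k) :
    Pairwise fun p p' => ∀ M N, Commute (blockHom owner p M) (blockHom owner p' N) :=
  fun _ _ h M N => commute_applyOn_of_disjoint (disjoint_block owner h) M N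

/-- The tensor product of one operator for every processor, as an operator on the register. -/
def localHom (owner : Q → Fin k) : (∀ p, QOp {q // q ∈ block owner p}) →* QOp Q :=
  MonoidHom.noncommPiCoprod (blockHom owner) (pairwise_commute_blockHom owner)

theorem localHom_mulSingle (owner : Q → Fin k) (p : Fin k) (M : QOp {q // q ∈ block owner p}) :
    localHom owner (Pi.mulSingle p M) = applyOn (block owner p) M :=
  MonoidHom.noncommPiCoprod_mulSingle _ _ _

open scoped Pointwise

/-- The products of a nonlocal gate and a local unitary for each of the two processors which it
touches. -/
def roundSet (owner : Q → Fin k) : Set (QOp Q) :=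
  ⋃ ab : Q × Q, gateSet {ab.1, ab.2} *
    (gateSet (block owner (owner ab.1)) * gateSet (block owner (owner ab.2)))

/-- The tensor products of local unitaries. -/
def localSet (owner : Q → Fin k) : Set (QOp Q) :=
  ((List.finRange k).map fun p => gateSet (block owner p)).prod

theorem localHom_mem_localSet (owner : Q → Fin k) (L : ∀ p, QOp {q // q ∈ block owner p})
    (hL : ∀ p, L p ∈ qUnitary _) : localHom owner L ∈ localSet owner := by
  have h1 : localHom owner L =
      ((List.finRange k).map fun p => applyOn (block owner p) (L p)).prod := by
    rw [localHom, MonoidHom.noncommPiCoprod_apply]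
    exact Multiset.noncommProd_coe _ _
  rw [h1, localSet]
  generalize List.finRange k = l
  induction l with
  | nil => simp
  | cons p l ih =>
    simp only [List.map_cons, List.prod_cons]
    exact Set.mul_mem_mul ⟨_, hL p, rfl⟩ ih

/-- Local unitaries on a processor commute with every gate that does not touch it, so they can be
moved to the left until a nonlocal gate touches their processor. Hence only two local unitaries
per nonlocal gate, and one more for every processor, are needed. -/
theorem CircuitOp.exists_normalForm {G : SimpleGraph (Fin k)} {owner : Q → Fin k} {l : ℕ}
    {W : QOp Q} (h : CircuitOp G owner l W) :
    ∃ L : ∀ p, QOp {q // q ∈ block owner p}, (∀ p, L p ∈ qUnitary _) ∧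
      ∃ R ∈ roundSet owner ^ l, W = localHom owner L * R := by
  induction h with
  | empty => exact ⟨1, fun p => one_mem _, 1, by simp, by simp⟩
  | @localGate l W p M hM hW ih =>
    obtain ⟨L, hL, R, hR, rfl⟩ := ih
    refine ⟨Pi.mulSingle p M * L, fun p' => ?_, R, hR, ?_⟩
    · rw [Pi.mul_apply]
      refine mul_mem ?_ (hL p')
      rcases eq_or_ne p' p with rfl | hne
      · simpa using hM
      · rw [Pi.mulSingle_eq_of_ne hne]
        exact one_mem _
    · rw [map_mul, localHom_mulSingle, mul_assoc]
  | @nonlocalGate l W a b hab M hM hW ih =>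
    obtain ⟨L, hL, R, hR, rfl⟩ := ih
    have hne : owner a ≠ owner b := hab.ne
    let L' : ∀ p, QOp {q // q ∈ block owner p} :=
      Function.update (Function.update L (owner a) 1) (owner b) 1
    have hsplit : L = L' * (Pi.mulSingle (owner a) (L (owner a)) *
        Pi.mulSingle (owner b) (L (owner b))) := by
      funext p
      simp only [L', Pi.mul_apply]
      by_cases hb : p = owner b
      · subst hb
        simp [Pi.mulSingle_eq_of_ne hne.symm]
      · by_cases ha : p = owner a
        · subst ha
          simp [hne]
        · simp [Function.update_of_ne ha, Function.update_of_ne hb, Pi.mulSingle_eq_of_ne ha,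
            Pi.mulSingle_eq_of_ne hb]
    have hcomm : Commute (applyOn {a, b} M) (localHom owner L') := by
      rw [localHom, MonoidHom.noncommPiCoprod_apply]
      refine Finset.noncommProd_induction _ _ _ (fun x => Commute (applyOn {a, b} M) x)
        (fun x y => Commute.mul_right) (Commute.one_right _) fun p _ => ?_
      by_cases hb : p = owner b
      · subst hb
        simp [L']
      · by_cases ha : p = owner a
        · subst ha
          simp [L', hne]
        · refine commute_applyOn_of_disjoint ?_ _ _
          rw [Finset.disjoint_left]
          intro q hq hq'
          simp only [block, Finset.mem_filter, Finset.mem_univ, true_and] at hq'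
          simp only [Finset.mem_insert, Finset.mem_singleton] at hq
          rcases hq with rfl | rfl
          · exact ha hq'.symm
          · exact hb hq'.symm
    refine ⟨L', fun p => ?_, applyOn {a, b} M * (applyOn (block owner (owner a)) (L (owner a)) *
      applyOn (block owner (owner b)) (L (owner b))) * R, ?_, ?_⟩
    · by_cases hb : p = owner b
      · subst hb
        simp [L', one_mem]
      · by_cases ha : p = owner a
        · subst ha
          simp [L', hne, one_mem]
        · simpa [L', Function.update_of_ne ha, Function.update_of_ne hb] using hL p
    · rw [pow_succ']
      refine Set.mul_mem_mul (Set.mem_iUnion.2 ⟨(a, b), ?_⟩) hR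
      exact Set.mul_mem_mul ⟨M, hM, rfl⟩ (Set.mul_mem_mul ⟨_, hL _, rfl⟩ ⟨_, hL _, rfl⟩)
    · conv_lhs => rw [hsplit]
      rw [map_mul, map_mul, localHom_mulSingle, localHom_mulSingle]
      simp only [← mul_assoc]
      rw [hcomm.eq]

/-- Every unitary of a circuit with `l` nonlocal gates is a product of `k + 3 * l` unitaries on
at most `s` qubits each. -/
theorem diamCover_circuitOp (G : SimpleGraph (Fin k)) (owner : Q → Fin k) {s : ℕ} (hs2 : 2 ≤ s)
    (hs : ∀ p, (block owner p).card ≤ s) {K : ℕ} (hK : 0 < K) (l : ℕ) :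
    DiamCover {W | CircuitOp G owner l W}
      (((2 * K + 1) ^ (2 * 4 ^ s)) ^ (k + 3 * l) * Fintype.card Q ^ (2 * l))
      ((k + 3 * l) * (4 ^ s * (2 / K))) := by
  set N := (2 * K + 1) ^ (2 * 4 ^ s) with hN
  set δ : ℝ := 4 ^ s * (2 / K)
  have hlocal := DiamCover.list_prod (A := fun p => gateSet (block owner p))
    (fun p => diamCover_gateSet (block owner p) (hs p) hK)
    (fun p x hx => norm_le_one_of_mem_gateSet hx) (List.finRange k)
  rw [List.length_finRange] at hlocal
  have hpair : ∀ ab : Q × Q, ∀ x ∈ gateSet (block owner (owner ab.1)) *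
      gateSet (block owner (owner ab.2)), ‖x‖ ≤ 1 := by
    rintro ab _ ⟨x, hx, y, hy, rfl⟩
    exact (norm_mul_le _ _).trans (mul_le_one₀ (norm_le_one_of_mem_gateSet hx) (norm_nonneg _)
      (norm_le_one_of_mem_gateSet hy))
  have hround : DiamCover (roundSet owner) (Fintype.card Q ^ 2 * N ^ 3) (3 * δ) := by
    have := DiamCover.iUnion fun ab : Q × Q =>
      (diamCover_gateSet {ab.1, ab.2} (Finset.card_le_two.trans hs2) hK).mul
        ((diamCover_gateSet (block owner (owner ab.1)) (hs _) hK).mul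
          (diamCover_gateSet (block owner (owner ab.2)) (hs _) hK)
          (fun x hx => norm_le_one_of_mem_gateSet hx) (fun x hx => norm_le_one_of_mem_gateSet hx))
        (fun x hx => norm_le_one_of_mem_gateSet hx) (hpair ab)
    refine this.mono subset_rfl (le_of_eq ?_) (le_of_eq ?_)
    · rw [Fintype.card_prod]; ring
    · ring
  have hround1 : ∀ x ∈ roundSet owner, ‖x‖ ≤ 1 := by
    intro x hx
    obtain ⟨ab, y, hy, z, hz, rfl⟩ := Set.mem_iUnion.1 hx
    exact (norm_mul_le _ _).trans (mul_le_one₀ (norm_le_one_of_mem_gateSet hy) (norm_nonneg _)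
      (hpair ab z hz))
  have hpow := hround.pow hround1 l
  refine (hlocal.1.mul hpow.1 hlocal.2 hpow.2).mono ?_ (le_of_eq ?_) (le_of_eq ?_)
  · intro W hW
    obtain ⟨L, hL, R, hR, rfl⟩ := CircuitOp.exists_normalForm hW
    exact ⟨_, localHom_mem_localSet owner L hL, R, hR, rfl⟩
  · rw [← hN, pow_add, pow_mul N 3 l, pow_mul _ 2 l, mul_pow]; ring
  · ring

end NormalForm

/-! ### Clean ancillas -/

open scoped Matrix in
theorem Matrix.l2_opNorm_submatrix_le {m n : Type*} [Fintype m] [DecidableEq m] [Fintype n]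
    [DecidableEq n] (A : Matrix m m ℂ) {f : n → m} (hf : Function.Injective f) :
    ‖A.submatrix f f‖ ≤ ‖A‖ := by
  let P : Matrix m n ℂ := (1 : Matrix m m ℂ).submatrix id f
  have hP : Pᴴ * P = 1 := by
    rw [Matrix.conjTranspose_submatrix, Matrix.conjTranspose_one]
    ext i j
    simp [P, Matrix.mul_apply, Matrix.one_apply, hf.eq_iff]
  have hP1 : ‖P‖ ≤ 1 := by
    have h := Matrix.l2_opNorm_conjTranspose_mul_self P
    rw [hP] at h
    have h1 := norm_le_one_of_mem_unitaryGroup (one_mem (Matrix.unitaryGroup n ℂ))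
    nlinarith [norm_nonneg P]
  have hA : A.submatrix f f = Pᴴ * (A * P) := by
    rw [Matrix.conjTranspose_submatrix, Matrix.conjTranspose_one]
    ext i j
    simp [P, Matrix.mul_apply, Matrix.one_apply]
  rw [hA]
  calc ‖Pᴴ * (A * P)‖ ≤ ‖Pᴴ‖ * (‖A‖ * ‖P‖) :=
        (Matrix.l2_opNorm_mul _ _).trans
          (mul_le_mul_of_nonneg_left (Matrix.l2_opNorm_mul _ _) (norm_nonneg _))
    _ ≤ 1 * (‖A‖ * 1) := by
        rw [Matrix.l2_opNorm_conjTranspose]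
        gcongr
    _ = ‖A‖ := by ring

/-- The bit string `i` on the input qubits, together with zeros on the ancilla qubits. -/
def padZero {n k m : ℕ} (i : Fin n → Fin 2) : Qubit n k m → Fin 2 := Sum.elim i 0

theorem padZero_injective {n k m : ℕ} : Function.Injective (padZero (n := n) (k := k) (m := m)) := by
  intro i j h
  funext a
  exact congrFun h (Sum.inl a)

theorem withAncillas_padZero {n k m : ℕ} (ψ : (Fin n → Fin 2) → ℂ) (i : Fin n → Fin 2) :
    withAncillas (k := k) (m := m) ψ (padZero i) = ψ i := by
  simp [withAncillas, padZero]

theorem withAncillas_single {n k m : ℕ} (j : Fin n → Fin 2) :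
    withAncillas (k := k) (m := m) (Pi.single j 1) = Pi.single (padZero j) 1 := by
  funext z
  by_cases hz : ∃ i, z = padZero i
  · obtain ⟨i, rfl⟩ := hz
    rw [withAncillas_padZero]
    simp only [Pi.single_apply, padZero_injective.eq_iff]
  · have h1 : ¬ ∀ a, z (Sum.inr a) = 0 := fun h =>
      hz ⟨fun i => z (Sum.inl i), by funext q; rcases q with q | q <;> simp [padZero, h]⟩
    have h2 : z ≠ padZero j := fun h => hz ⟨j, h⟩
    rw [withAncillas, if_neg h1, Pi.single_eq_of_ne h2]

theorem Implements.eq_submatrix {n k m : ℕ} {W : QOp (Qubit n k m)} {V : QOp (Fin n)}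
    (h : Implements W V) : V = W.submatrix padZero padZero := by
  ext i j
  have := congrFun (h (Pi.single j 1)) (padZero i)
  rw [withAncillas_single, withAncillas_padZero, Matrix.mulVec_single_one,
    Matrix.mulVec_single_one] at this
  exact this.symm

/-- The operators that some circuit with `l` nonlocal gates implements, for a fixed partition. -/
theorem diamCover_implements {n k m : ℕ} (G : SimpleGraph (Fin k)) (π : Fin n → Fin k) {s : ℕ}
    (hs2 : 2 ≤ s) (hs : ∀ p, (Finset.univ.filter fun i => π i = p).card + m ≤ s) {K : ℕ}
    (hK : 0 < K) (l : ℕ) :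
    DiamCover {V : QOp (Fin n) | ∃ W : QOp (Qubit n k m), CircuitOp G (ownerOf π) l W ∧
        Implements W V}
      (((2 * K + 1) ^ (2 * 4 ^ s)) ^ (k + 3 * l) * (n + k * m) ^ (2 * l))
      ((k + 3 * l) * (4 ^ s * (2 / K))) := by
  have hblock : ∀ p, (block (ownerOf (m := m) π) p).card ≤ s := by
    intro p
    refine le_trans (le_of_eq ?_) (hs p)
    have : block (ownerOf (m := m) π) p =
        (Finset.univ.filter fun i => π i = p).disjSum ({p} ×ˢ Finset.univ) := by
      ext q
      rcases q with q | ⟨q, r⟩ <;> simp [block, ownerOf, eq_comm]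
    rw [this, Finset.card_disjSum, Finset.card_product]
    simp
  have h := (diamCover_circuitOp G (ownerOf (m := m) π) hs2 hblock hK l).image
    (fun W => W.submatrix (padZero (n := n)) padZero) ?_
  · rw [Fintype.card_sum, Fintype.card_prod, Fintype.card_fin, Fintype.card_fin,
      Fintype.card_fin] at h
    refine h.mono ?_ le_rfl le_rfl
    rintro V ⟨W, hW, hV⟩
    exact ⟨W, hW, hV.eq_submatrix.symm⟩
  · intro W W'
    rw [dist_eq_norm, dist_eq_norm]
    exact Matrix.l2_opNorm_submatrix_le (W - W') padZero_injective

/-! ### Circuits with few nonlocal gates give product operators -/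

section Product

/-- The bit string which agrees with `x` on `A` and with `y` off `A`. -/
def mix {Q : Type} [DecidableEq Q] (A : Finset Q) (x y : Q → Fin 2) : Q → Fin 2 :=
  fun q => if q ∈ A then x q else y q

/-- `W` is a tensor product of an operator on `A` and an operator on the other qubits. This is
expressed without reference to the factors: `W ⊗ W` on two copies of the register is unchanged
if the two copies of `A` are exchanged. -/
def IsProductAcross {Q : Type} [DecidableEq Q] (A : Finset Q) (W : QOp Q) : Prop :=
  ∀ x x' y y', W x y * W x' y' = W (mix A x x') (mix A y y') * W (mix A x' x) (mix A y' y)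

theorem mix_mix {Q : Type} [DecidableEq Q] (A : Finset Q) (x y : Q → Fin 2) :
    mix A (mix A x y) (mix A y x) = x := by
  funext q
  simp only [mix]
  split_ifs <;> rfl

variable {Q : Type} [Fintype Q] [DecidableEq Q]

theorem IsProductAcross.mul {A : Finset Q} {W Z : QOp Q} (hW : IsProductAcross A W)
    (hZ : IsProductAcross A Z) : IsProductAcross A (W * Z) := by
  intro x x' y y'
  simp only [Matrix.mul_apply, Finset.sum_mul_sum, ← Finset.sum_product']
  refine Finset.sum_nbij' (fun z => (mix A z.1 z.2, mix A z.2 z.1))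
    (fun z => (mix A z.1 z.2, mix A z.2 z.1)) (by simp) (by simp) ?_ ?_ ?_
  · intro z _; simp [mix_mix]
  · intro z _; simp [mix_mix]
  · intro z _
    rw [mul_mul_mul_comm, hW, hZ, mul_mul_mul_comm]

theorem isProductAcross_applyOn {A S : Finset Q} (h : S ⊆ A ∨ Disjoint S A)
    (M : QOp {q // q ∈ S}) : IsProductAcross A (applyOn S M) := by
  intro x x' y y'
  have hcond : ((∀ q, q ∉ S → mix A x x' q = mix A y y' q) ∧
      ∀ q, q ∉ S → mix A x' x q = mix A y' y q) ↔
      (∀ q, q ∉ S → x q = y q) ∧ ∀ q, q ∉ S → x' q = y' q := by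
    simp only [mix, ← forall_and]
    refine forall_congr' fun q => forall_congr' fun _ => ?_
    split_ifs
    · exact Iff.rfl
    · exact and_comm
  have hprod : ∀ a b : ℂ, ∀ p q : Prop, ∀ [Decidable p] [Decidable q],
      (if p then a else 0) * (if q then b else 0) = if p ∧ q then a * b else 0 := by
    intro a b p q _ _
    by_cases hp : p <;> by_cases hq : q <;> simp [hp, hq]
  simp only [applyOn]
  rw [hprod, hprod]
  simp only [hcond]
  congr 1
  rcases h with h | h
  · have e : ∀ u v : Q → Fin 2, (fun q : {q // q ∈ S} => mix A u v q.1) = fun q => u q.1 := by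
      intro u v; funext q; simp [mix, h q.2]
    simp only [e]
  · have e : ∀ u v : Q → Fin 2, (fun q : {q // q ∈ S} => mix A u v q.1) = fun q => v q.1 := by
      intro u v; funext q; simp [mix, Finset.disjoint_left.1 h q.2]
    simp only [e, mul_comm]

/-- The nonlocal gates connect the processors into classes. As every gate merges at most two
classes, `l` gates leave at least `k - l` of them, and the circuit is a product across every
union of classes. -/
theorem CircuitOp.exists_classes {k : ℕ} {G : SimpleGraph (Fin k)} {owner : Q → Fin k} {l : ℕ}
    {W : QOp Q} (h : CircuitOp G owner l W) :
    ∃ c : Fin k → Fin k, k ≤ (Finset.univ.image c).card + l ∧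
      ∀ T : Finset (Fin k), (∀ p p', c p = c p' → (p ∈ T ↔ p' ∈ T)) →
        IsProductAcross (Finset.univ.filter fun q => owner q ∈ T) W := by
  induction h with
  | empty =>
    refine ⟨id, by simp, fun T _ => ?_⟩
    rw [← applyOn_one ∅]
    exact isProductAcross_applyOn (Or.inl (Finset.empty_subset _)) _
  | @localGate l W p M hM hW ih =>
    obtain ⟨c, hc, hT⟩ := ih
    refine ⟨c, hc, fun T hsat => (isProductAcross_applyOn ?_ M).mul (hT T hsat)⟩
    by_cases hp : p ∈ T
    · left
      intro q hq
      simp only [Finset.mem_filter, Finset.mem_univ, true_and] at hq ⊢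
      rwa [hq]
    · right
      rw [Finset.disjoint_left]
      intro q hq hq'
      simp only [Finset.mem_filter, Finset.mem_univ, true_and] at hq hq'
      rw [hq] at hq'
      exact hp hq'
  | @nonlocalGate l W a b hab M hM hW ih =>
    obtain ⟨c, hc, hT⟩ := ih
    refine ⟨fun p => if c p = c (owner a) then c (owner b) else c p, ?_, fun T hsat => ?_⟩
    · have hsub : Finset.univ.image c ⊆ insert (c (owner a))
          (Finset.univ.image fun p => if c p = c (owner a) then c (owner b) else c p) := by
        intro v hv
        obtain ⟨p, -, rfl⟩ := Finset.mem_image.1 hv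
        by_cases hp : c p = c (owner a)
        · rw [hp]; exact Finset.mem_insert_self _ _
        · exact Finset.mem_insert_of_mem (Finset.mem_image.2 ⟨p, Finset.mem_univ _, by simp [hp]⟩)
      have h1 := Finset.card_le_card hsub
      have h2 := h1.trans (Finset.card_insert_le _ _)
      omega
    · have hab' : owner a ∈ T ↔ owner b ∈ T := hsat _ _ (by simp)
      refine (isProductAcross_applyOn ?_ M).mul (hT T fun p p' hpp' => hsat p p' (by simp [hpp']))
      by_cases ha : owner a ∈ T
      · left
        intro q hq
        simp only [Finset.mem_insert, Finset.mem_singleton] at hq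
        rcases hq with rfl | rfl
        · simpa using ha
        · simpa using hab'.1 ha
      · right
        rw [Finset.disjoint_left]
        intro q hq
        simp only [Finset.mem_insert, Finset.mem_singleton] at hq
        rcases hq with rfl | rfl
        · simpa using ha
        · simpa using fun h => ha (hab'.2 h)

/-- If every occupied processor were in one class, there would be at most
`1 + (k - number of occupied processors)` classes. -/
theorem exists_ne_of_card_image {n k l : ℕ} (π : Fin n → Fin k) (c : Fin k → Fin k)
    (hc : k ≤ (Finset.univ.image c).card + l) (hl : l + 1 < (Finset.univ.image π).card) :
    ∃ i j, c (π i) ≠ c (π j) := by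
  by_contra! hall
  have hne : (Finset.univ.image π).Nonempty := Finset.card_pos.1 (by omega)
  obtain ⟨p, hp⟩ := hne
  obtain ⟨i, -, rfl⟩ := Finset.mem_image.1 hp
  have hsub : Finset.univ.image c ⊆
      insert (c (π i)) ((Finset.univ \ Finset.univ.image π).image c) := by
    intro v hv
    obtain ⟨p, -, rfl⟩ := Finset.mem_image.1 hv
    by_cases hp : p ∈ Finset.univ.image π
    · obtain ⟨j, -, rfl⟩ := Finset.mem_image.1 hp
      rw [hall j i]; exact Finset.mem_insert_self _ _
    · exact Finset.mem_insert_of_mem (Finset.mem_image_of_mem _ (by simpa using hp))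
  have h1 := (Finset.card_le_card hsub).trans (Finset.card_insert_le _ _)
  have h2 := h1.trans (Nat.add_le_add_right Finset.card_image_le 1)
  rw [Finset.card_sdiff_of_subset (Finset.subset_univ _), Finset.card_univ, Fintype.card_fin] at h2
  have h3 : (Finset.univ.image π).card ≤ k := by
    simpa using Finset.card_le_univ (Finset.univ.image π)
  omega

end Product

/-- The diagonal unitary that changes the sign of the basis states of Hamming weight two. -/
def weightTwoPhase (n : ℕ) : QOp (Fin n) :=
  Matrix.diagonal fun x => if (Finset.univ.filter fun i => x i = 1).card = 2 then -1 else 1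

theorem weightTwoPhase_mem_qUnitary (n : ℕ) : weightTwoPhase n ∈ qUnitary (Fin n) := by
  rw [Matrix.mem_unitaryGroup_iff, weightTwoPhase, Matrix.star_eq_conjTranspose,
    Matrix.diagonal_conjTranspose, Matrix.diagonal_mul_diagonal, ← Matrix.diagonal_one]
  congr 1
  funext x
  simp only [Pi.star_apply]
  split_ifs <;> simp

/-- For a product operator `V` across a set that separates `i` from `j`, the diagonal entries at
the bit strings `0`, `e_i`, `e_j`, `e_i + e_j` satisfy
`V(0) * V(e_i + e_j) = V(e_j) * V(e_i)`. For `weightTwoPhase` the two sides are `-1` and `1`. -/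
theorem not_isProductAcross_of_near_weightTwoPhase {n : ℕ} {V : QOp (Fin n)}
    (hV : ‖V - weightTwoPhase n‖ ≤ 1 / 20) {A : Finset (Fin n)} {i j : Fin n} (hi : i ∈ A)
    (hj : j ∉ A) : ¬ IsProductAcross A V := by
  intro h
  have hij : i ≠ j := fun e => hj (e ▸ hi)
  have hent : ∀ x, ‖V x x - weightTwoPhase n x x‖ ≤ 1 / 20 := fun x =>
    (Matrix.norm_entry_le_l2_opNorm (V - weightTwoPhase n) x x).trans hV
  let e : Finset (Fin n) → Fin n → Fin 2 := fun S q => if q ∈ S then 1 else 0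
  have hphase : ∀ S, weightTwoPhase n (e S) (e S) = if S.card = 2 then -1 else 1 := by
    intro S
    simp [weightTwoPhase, e]
  have h0 := hent (e ∅)
  have hi1 := hent (e {i})
  have hj1 := hent (e {j})
  have hij1 := hent (e {i, j})
  rw [hphase] at h0 hi1 hj1 hij1
  rw [if_pos (Finset.card_pair hij)] at hij1
  simp only [Finset.card_empty, Finset.card_singleton] at h0 hi1 hj1
  norm_num at h0 hi1 hj1 hij1
  have key := h (e ∅) (e {i, j}) (e ∅) (e {i, j})
  have m1 : mix A (e ∅) (e {i, j}) = e {j} := by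
    funext q
    by_cases hq : q ∈ A
    · have : q ≠ j := fun h => hj (h ▸ hq)
      simp [mix, e, hq, this]
    · have : q ≠ i := fun h => hq (h ▸ hi)
      simp [mix, e, hq, this]
  have m2 : mix A (e {i, j}) (e ∅) = e {i} := by
    funext q
    by_cases hq : q ∈ A
    · have : q ≠ j := fun h => hj (h ▸ hq)
      simp [mix, e, hq, this]
    · have : q ≠ i := fun h => hq (h ▸ hi)
      simp [mix, e, hq, this]
  rw [m1, m2] at key
  generalize V (e ∅) (e ∅) = a at *
  generalize V (e {i, j}) (e {i, j}) = b at *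
  generalize V (e {i}) (e {i}) = c at *
  generalize V (e {j}) (e {j}) = d at *
  have hsum : (a - 1) * (b + 1) - (a - 1) + (b + 1) - (d - 1) * (c - 1) - (d - 1) - (c - 1) = 2 := by
    linear_combination key
  have hnorm : ‖(a - 1) * (b + 1) - (a - 1) + (b + 1) - (d - 1) * (c - 1) - (d - 1) - (c - 1)‖ ≤
      1 / 20 * (1 / 20) + 1 / 20 + 1 / 20 + 1 / 20 * (1 / 20) + 1 / 20 + 1 / 20 := by
    refine norm_sub_le_of_le (norm_sub_le_of_le (norm_sub_le_of_le (norm_add_le_of_le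
      (norm_sub_le_of_le ?_ h0) hij1) ?_) hj1) hi1
    · rw [norm_mul]; exact mul_le_mul h0 hij1 (norm_nonneg _) (by norm_num)
    · rw [norm_mul]; exact mul_le_mul hj1 hi1 (norm_nonneg _) (by norm_num)
  rw [hsum] at hnorm
  norm_num at hnorm

/-- Nonlocal gates have to connect all the processors which hold an input qubit. -/
theorem card_occupied_le_of_near_weightTwoPhase {n k m l : ℕ} {G : SimpleGraph (Fin k)}
    {π : Fin n → Fin k} {V : QOp (Fin n)} (hV : ‖V - weightTwoPhase n‖ ≤ 1 / 20)
    {W : QOp (Qubit n k m)} (hW : CircuitOp G (ownerOf π) l W) (hWV : Implements W V) :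
    (Finset.univ.image π).card ≤ l + 1 := by
  by_contra! hl
  obtain ⟨c, hc, hT⟩ := CircuitOp.exists_classes hW
  obtain ⟨i, j, hij⟩ := exists_ne_of_card_image π c hc hl
  let T : Finset (Fin k) := Finset.univ.filter fun p => c p = c (π i)
  have hprod := hT T fun p p' hpp' => by simp [T, hpp']
  refine not_isProductAcross_of_near_weightTwoPhase hV
    (A := Finset.univ.filter fun q => π q ∈ T) (i := i) (j := j) (by simp [T])
    (by simpa [T] using Ne.symm hij) ?_
  have hpad : ∀ x y : Fin n → Fin 2, mix (Finset.univ.filter fun q => ownerOf (m := m) π q ∈ T)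
      (padZero x) (padZero y) = padZero (mix (Finset.univ.filter fun q => π q ∈ T) x y) := by
    intro x y
    funext q
    simp only [mix, Finset.mem_filter, Finset.mem_univ, true_and]
    rcases q with q | q
    · simp only [padZero, ownerOf, Sum.elim_inl, mix, Finset.mem_filter, Finset.mem_univ, true_and]
      rfl
    · simp [padZero]
  intro x x' y y'
  simp only [hWV.eq_submatrix, Matrix.submatrix_apply, ← hpad]
  exact hprod _ _ _ _

/-! ### Comparing the two entropies -/

theorem ofReal_le_approxPartyComplexity {n m k : ℕ} {B r ε : ℝ} {U : QOp (Fin n)}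
    (h : ∀ V ∈ qUnitary (Fin n), ‖V - U‖ ≤ ε → ∀ π : Fin n → Fin k, IsBalanced B π →
      ∀ (l : ℕ) (W : QOp (Qubit n k m)), CircuitOp ⊤ (ownerOf π) l W → Implements W V → r ≤ l) :
    ENNReal.ofReal r ≤ ((approxPartyComplexity B m k U ε : ℕ∞) : ℝ≥0∞) := by
  have h1 : ((⌈r⌉₊ : ℕ) : ℕ∞) ≤ approxPartyComplexity B m k U ε := by
    refine le_iInf fun V => le_iInf fun hV => le_iInf fun hVU => le_iInf fun π => le_iInf fun hπ =>
      le_iInf fun l => le_iInf ?_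
    rintro ⟨W, hW, hWV⟩
    exact_mod_cast Nat.ceil_le.2 (h V hV hVU π hπ l W hW hWV)
  calc ENNReal.ofReal r ≤ ENNReal.ofReal ((⌈r⌉₊ : ℕ) : ℝ) :=
        ENNReal.ofReal_le_ofReal (Nat.le_ceil r)
    _ = (((⌈r⌉₊ : ℕ) : ℕ∞) : ℝ≥0∞) := by rw [ENNReal.ofReal_natCast]; simp
    _ ≤ _ := by exact_mod_cast h1

theorem IsBalanced.card_le {n k b : ℕ} {B : ℝ} (hB : B ≤ b) {π : Fin n → Fin k}
    (hπ : IsBalanced B π) (p : Fin k) :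
    (Finset.univ.filter fun i => π i = p).card ≤ n / k + b := by
  have hk : 0 < k := p.pos
  have hk' : (0 : ℝ) < k := by exact_mod_cast hk
  have h1 := (abs_le.1 (hπ p)).2.trans hB
  set f := (Finset.univ.filter fun i => π i = p).card
  by_contra! hlt
  have h2 : n / k + 1 ≤ f - b := by omega
  have h3 : n < (n / k + 1) * k := by
    have := Nat.lt_div_mul_add hk (a := n)
    nlinarith
  have h4 : (n : ℝ) / k < (n / k + 1 : ℕ) := by
    rw [div_lt_iff₀ hk']; exact_mod_cast h3
  have h5 : ((n / k + 1 : ℕ) : ℝ) + b ≤ f := by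
    have : n / k + 1 + b ≤ f := by omega
    exact_mod_cast this
  linarith

/-- The unitaries implemented by circuits with at most `L` nonlocal gates, for any balanced
partition. The mesh of the grid is chosen such that the parts have diameter at most `ε`. -/
theorem diamCover_cheap {n k m b L : ℕ} {B ε : ℝ} (hB : B ≤ b) (hn : 0 < n)
    (hk : 2 ≤ k) (hε : ((2 : ℝ) ^ n)⁻¹ ≤ ε) :
    DiamCover {V : QOp (Fin n) | ∃ π : Fin n → Fin k, IsBalanced B π ∧ ∃ l ≤ L,
        ∃ W : QOp (Qubit n k m), CircuitOp ⊤ (ownerOf π) l W ∧ Implements W V}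
      (k ^ n * (L + 1) * (((2 * ((k + 3 * L) * 4 ^ (n / k + b + m + 2) * 2 * 2 ^ n) + 1) ^
        (2 * 4 ^ (n / k + b + m + 2))) ^ (k + 3 * L) * (n + k * m) ^ (2 * L))) ε := by
  set s := n / k + b + m + 2 with hs
  set K := (k + 3 * L) * 4 ^ s * 2 * 2 ^ n with hKdef
  have hK : 0 < K := by positivity
  clear_value s
  have hK' : ((K : ℕ) : ℝ) = (k + 3 * L) * 4 ^ s * 2 * 2 ^ n := by
    rw [hKdef]; push_cast; ring
  have hkR : (0 : ℝ) < k := by exact_mod_cast (by omega : 0 < k)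
  have hδ : ((k : ℝ) + 3 * L) * (4 ^ s * (2 / K)) ≤ ε := by
    refine le_trans (le_of_eq ?_) hε
    have : (0 : ℝ) < k + 3 * L := by positivity
    rw [hK']
    field_simp
  have := DiamCover.iUnion (ι := (Fin n → Fin k) × Fin (L + 1))
    (A := fun i => {V : QOp (Fin n) | IsBalanced B i.1 ∧
        ∃ W : QOp (Qubit n k m), CircuitOp ⊤ (ownerOf i.1) i.2 W ∧ Implements W V})
    (N := ((2 * K + 1) ^ (2 * 4 ^ s)) ^ (k + 3 * L) * (n + k * m) ^ (2 * L)) (δ := ε) ?_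
  · rw [Fintype.card_prod, Fintype.card_fun, Fintype.card_fin, Fintype.card_fin,
      Fintype.card_fin] at this
    refine this.mono ?_ le_rfl le_rfl
    rintro V ⟨π, hπ, l, hl, W, hW⟩
    exact Set.mem_iUnion.2 ⟨(π, ⟨l, Nat.lt_succ_of_le hl⟩), hπ, W, hW⟩
  · rintro ⟨π, l⟩
    by_cases hπ : IsBalanced B π
    · have hl : (l : ℕ) ≤ L := Nat.le_of_lt_succ l.2
      refine (diamCover_implements (m := m) ⊤ π (s := s) (by rw [hs]; exact Nat.le_add_left 2 _)
        (fun p => ?_) hK l).mono (fun V hV => hV.2) ?_ (le_trans ?_ hδ)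
      · have := IsBalanced.card_le hB hπ p
        rw [hs]; linarith
      · gcongr
        all_goals first
          | exact Nat.le_add_right_of_le hn
          | exact Nat.one_le_iff_ne_zero.2 (by positivity)
      · gcongr
    · refine (DiamCover.singleton (0 : QOp (Fin n))).mono (fun V hV => absurd hV.1 hπ) ?_
        ((by positivity : (0:ℝ) ≤ ((2 : ℝ) ^ n)⁻¹).trans hε)
      exact Nat.one_le_iff_ne_zero.2 (by positivity)

/-- Every factor of the number of parts in `diamCover_cheap` is at most a power of two. -/
theorem card_parts_le_two_pow {n k m b L s : ℕ} (hn2 : 2 ≤ n) (hk : 2 ≤ k) (hkn : k ≤ n)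
    (hmn : m ≤ n) (hs : s ≤ n + b + 2) (hkLn : k + 3 * L ≤ 4 ^ n) :
    k ^ n * (L + 1) * (((2 * ((k + 3 * L) * 4 ^ s * 2 * 2 ^ n) + 1) ^
      (2 * 4 ^ s)) ^ (k + 3 * L) * (n + k * m) ^ (2 * L)) ≤
      2 ^ (n * n + n * L + ((2 * b + 9) * n * (2 * 4 ^ s) * (k + 3 * L) + 2 * n * (2 * L))) := by
  have hnpow : n + 1 ≤ 2 ^ n := Nat.lt_two_pow_self
  have hmesh : 2 * ((k + 3 * L) * 4 ^ s * 2 * 2 ^ n) + 1 ≤ 2 ^ ((2 * b + 9) * n) := by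
    have h1 : 1 ≤ (k + 3 * L) * 4 ^ s * 2 * 2 ^ n :=
      Nat.one_le_iff_ne_zero.2 (by positivity)
    have h2 : (4 : ℕ) ^ s ≤ 4 ^ (n + b + 2) := Nat.pow_le_pow_right (by norm_num) hs
    calc 2 * ((k + 3 * L) * 4 ^ s * 2 * 2 ^ n) + 1
        ≤ 4 * ((k + 3 * L) * 4 ^ s * 2 * 2 ^ n) := by linarith
      _ ≤ 4 * (4 ^ n * 4 ^ (n + b + 2) * 2 * 2 ^ n) := by gcongr
      _ = 2 ^ (5 * n + 2 * b + 7) := by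
          rw [show (4 : ℕ) = 2 ^ 2 by norm_num, ← pow_mul, ← pow_mul]; ring
      _ ≤ 2 ^ ((2 * b + 9) * n) := Nat.pow_le_pow_right (by norm_num) (by nlinarith)
  have hqubits : n + k * m ≤ 2 ^ (2 * n) := by
    calc n + k * m ≤ n + n * n := by gcongr
      _ ≤ 2 ^ n * 2 ^ n := by nlinarith
      _ = 2 ^ (2 * n) := by rw [two_mul, pow_add]
  have hkn2 : k ^ n ≤ 2 ^ (n * n) := by
    rw [pow_mul]
    exact Nat.pow_le_pow_left (by omega) _
  have hL1 : L + 1 ≤ 2 ^ (n * L) :=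
    Nat.lt_two_pow_self.trans_le
      (Nat.pow_le_pow_right (by norm_num) (Nat.le_mul_of_pos_left L (by omega)))
  calc _ ≤ 2 ^ (n * n) * 2 ^ (n * L) * (((2 ^ ((2 * b + 9) * n)) ^ (2 * 4 ^ s)) ^ (k + 3 * L) *
        (2 ^ (2 * n)) ^ (2 * L)) := by gcongr
    _ = _ := by rw [← pow_mul, ← pow_mul, ← pow_mul, ← pow_add, ← pow_add, ← pow_add,
          mul_assoc ((2 * b + 9) * n)]

theorem natCast_mul_pow_lt_one {N E D : ℕ} {t : ℝ} (ht : 0 < t) (hN : N ≤ 2 ^ E)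
    (hE : (E : ℝ) < D * -Real.log t) : (N : ℝ) * t ^ D < 1 := by
  have hN' : (N : ℝ) ≤ 2 ^ E := by exact_mod_cast hN
  refine lt_of_le_of_lt (mul_le_mul_of_nonneg_right hN' (by positivity)) ?_
  rw [← Real.log_neg_iff (by positivity), Real.log_mul (by positivity) (by positivity),
    Real.log_pow, Real.log_pow]
  have h2 := Real.log_two_lt_d9
  have h3 : (E : ℝ) * Real.log 2 ≤ E :=
    mul_le_of_le_one_right (Nat.cast_nonneg E) (by linarith)
  linarith

/-- With `Y = 4 ^ ((1 - 1 / k) * n - m)` and `lam = log (1 / ε)`, the exponent in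
`card_parts_le_two_pow` is less than `4 ^ n * log (1 / ε) / 2` if the number `L` of
gates and the number `k` of processors are small. -/
theorem exponent_lt {n k m b L s : ℕ} {X Y lam : ℝ} (hn2 : 2 ≤ n) (hlam2 : 2 ≤ lam)
    (hnX : n * X = Y * lam) (hY4 : Y ≤ 4 ^ n) (hYs : Y * 4 ^ (n / k + m) ≤ 4 ^ n)
    (hkL : (k + 3 * L : ℝ) ≤ X / (16 * ((2 * b + 9) * 4 ^ (b + 2)))) (hL : (40 : ℝ) * L ≤ X)
    (hs : s = n / k + b + m + 2) :
    (n * n + n * L + ((2 * b + 9) * n * (2 * 4 ^ s) * (k + 3 * L) + 2 * n * (2 * L)) : ℝ) <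
      4 ^ n * (lam / 2) := by
  have hlam0 : 0 ≤ lam := by linarith
  have hE1 : (n : ℝ) * n ≤ 4 ^ n * lam / 8 := by
    have h4 : ∀ j : ℕ, 2 ≤ j → 4 * (j * j) ≤ 4 ^ j := by
      intro j hj
      induction j, hj using Nat.le_induction with
      | base => norm_num
      | succ j hj ih => rw [pow_succ]; nlinarith
    have h5 : (4 : ℝ) * (n * n) ≤ 4 ^ n := by exact_mod_cast h4 n hn2
    have h6 : (4 : ℝ) ^ n * 2 ≤ 4 ^ n * lam := mul_le_mul_of_nonneg_left hlam2 (by positivity)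
    linarith
  have hYlam : Y * lam ≤ 4 ^ n * lam := mul_le_mul_of_nonneg_right hY4 hlam0
  have hE2 : 5 * ((n : ℝ) * L) ≤ 4 ^ n * lam / 8 := by
    have h1 := mul_le_mul_of_nonneg_left hL (Nat.cast_nonneg (α := ℝ) n)
    linarith
  have hE3 : (2 * b + 9 : ℝ) * n * (2 * 4 ^ s) * (k + 3 * L) ≤ 4 ^ n * lam / 8 := by
    have key : ∀ β q t u x : ℝ, β ≠ 0 → q ≠ 0 →
        β * u * (2 * (q * t)) * (x / (16 * (β * q))) = u * x * t / 8 := by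
      intro β q t u x hβ hq
      field_simp
      ring
    have e : (4 : ℝ) ^ s = 4 ^ (b + 2) * 4 ^ (n / k + m) := by
      rw [← pow_add, hs]; congr 1; ring
    calc (2 * b + 9 : ℝ) * n * (2 * 4 ^ s) * (k + 3 * L)
        ≤ (2 * b + 9 : ℝ) * n * (2 * 4 ^ s) * (X / (16 * ((2 * b + 9) * 4 ^ (b + 2)))) :=
          mul_le_mul_of_nonneg_left hkL (by positivity)
      _ = (n * X) * 4 ^ (n / k + m) / 8 := by
          rw [e]
          exact key _ _ _ _ _ (by positivity) (by positivity)
      _ = (Y * 4 ^ (n / k + m)) * lam / 8 := by rw [hnX]; ring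
      _ ≤ 4 ^ n * lam / 8 := by gcongr
  have h3 : (0 : ℝ) < 4 ^ n * lam := by positivity
  linarith

/-- The number of parts in `diamCover_cheap` is too small to cover the unitary group with parts of
diameter `3 * ε`. The constants `32` and `96` give `k + 3 * L ≤ X / (16 * M)`, where `X` is the
right-hand side of `hX` and `hL` and `M = (2 * b + 9) * 4 ^ (b + 2)`; then the local unitaries
account for at most an eighth of `4 ^ n * log (1 / ε)`. -/
theorem card_parts_mul_lt_one {n k m b L : ℕ} {ε : ℝ} (hk : 2 ≤ k) (hkn : k ≤ n)
    (hε : ((2 : ℝ) ^ n)⁻¹ ≤ ε) (hε1 : ε ≤ 1 / 20)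
    (hX : 32 * ((2 * b + 9) * 4 ^ (b + 2) : ℝ) * k ≤
      (4 : ℝ) ^ ((1 - 1 / (k : ℝ)) * n - m) * Real.log (1 / ε) / n)
    (hL : 96 * ((2 * b + 9) * 4 ^ (b + 2) : ℝ) * L ≤
      (4 : ℝ) ^ ((1 - 1 / (k : ℝ)) * n - m) * Real.log (1 / ε) / n) :
    ((k ^ n * (L + 1) * (((2 * ((k + 3 * L) * 4 ^ (n / k + b + m + 2) * 2 * 2 ^ n) + 1) ^
        (2 * 4 ^ (n / k + b + m + 2))) ^ (k + 3 * L) * (n + k * m) ^ (2 * L)) : ℕ) : ℝ) *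
      (3 * ε) ^ (4 ^ n) < 1 := by
  set s := n / k + b + m + 2 with hs
  set Y := (4 : ℝ) ^ ((1 - 1 / (k : ℝ)) * n - m) with hY
  set lam := Real.log (1 / ε) with hlam
  set M : ℝ := (2 * b + 9) * 4 ^ (b + 2) with hM
  set X := Y * lam / n with hXdef
  have hn2 : 2 ≤ n := hk.trans hkn
  have hnR : (2 : ℝ) ≤ n := by exact_mod_cast hn2
  have hkR : (2 : ℝ) ≤ k := by exact_mod_cast hk
  have hε0 : 0 < ε := lt_of_lt_of_le (by positivity) hε
  have hYpos : 0 < Y := Real.rpow_pos_of_pos (by norm_num) _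
  have hM144 : 144 ≤ M := by
    have h1 : (16 : ℝ) ≤ 4 ^ (b + 2) := by
      have := one_le_pow₀ (M₀ := ℝ) (a := 4) (by norm_num) (n := b)
      rw [pow_add]; linarith
    have h2 : (9 : ℝ) ≤ 2 * b + 9 := by linarith [(Nat.cast_nonneg b : (0 : ℝ) ≤ b)]
    rw [hM]; nlinarith
  clear_value s Y M
  -- Bounds on `log (1 / ε)`.
  have hlam_eq : lam = -Real.log ε := by rw [hlam, one_div, Real.log_inv]
  have hlog : 2 * Real.log 3 ≤ lam ∧ 2 ≤ lam := by
    have h9 : Real.log 9 ≤ lam := by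
      refine Real.log_le_log (by norm_num) ?_
      rw [le_div_iff₀ hε0]; linarith
    have h93 : Real.log 9 = 2 * Real.log 3 := by
      rw [← Real.log_rpow (by norm_num)]; norm_num
    have h3 : 1 ≤ Real.log 3 := by
      rw [Real.le_log_iff_exp_le (by norm_num)]
      exact (Real.exp_one_lt_d9.le.trans (by norm_num))
    constructor <;> linarith
  have hlam2 : 2 ≤ lam := hlog.2
  have hlam3 : lam / 2 ≤ -Real.log (3 * ε) := by
    rw [Real.log_mul (by norm_num) hε0.ne']
    linarith [hlog.1]
  have hlamn : lam ≤ n := by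
    have h1 : Real.log ((2 : ℝ) ^ n)⁻¹ ≤ Real.log ε := Real.log_le_log (by positivity) hε
    rw [Real.log_inv, Real.log_pow] at h1
    have := Real.log_two_lt_d9
    rw [hlam_eq]
    nlinarith
  clear_value lam
  have hXpos : 0 ≤ X := by positivity
  have hXY : X ≤ Y := by
    rw [hXdef, div_le_iff₀ (by linarith)]
    exact mul_le_mul_of_nonneg_left hlamn hYpos.le
  have hnX : n * X = Y * lam := by rw [hXdef]; field_simp
  clear_value X
  have hkL : (k + 3 * L : ℝ) ≤ X / (16 * M) := by
    rw [le_div_iff₀ (by linarith)]; nlinarith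
  have hkLX : (k + 3 * L : ℝ) ≤ X :=
    hkL.trans (div_le_self hXpos (by linarith))
  -- Hence `m ≤ (1 - 1 / k) * n`, since otherwise `Y < 1`.
  have hexp : 0 ≤ (1 - 1 / (k : ℝ)) * n - m := by
    by_contra! hneg
    have : Y < 1 := hY ▸ Real.rpow_lt_one_of_one_lt_of_neg (by norm_num) hneg
    have hL0 : (0 : ℝ) ≤ L := Nat.cast_nonneg _
    linarith
  have hnk : ((n / k : ℕ) : ℝ) ≤ 1 / (k : ℝ) * n := by
    rw [one_div, inv_mul_eq_div]; exact Nat.cast_div_le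
  have hmn : n / k + m ≤ n := by
    have : ((n / k : ℕ) : ℝ) + m ≤ n := by linarith
    exact_mod_cast this
  have hY4 : Y ≤ 4 ^ n := by
    rw [← Real.rpow_natCast, hY]
    refine Real.rpow_le_rpow_of_exponent_le (by norm_num) ?_
    have : 0 ≤ 1 / (k : ℝ) * n := by positivity
    have := (Nat.cast_nonneg m : (0 : ℝ) ≤ m)
    linarith
  have hYs : Y * 4 ^ (n / k + m) ≤ 4 ^ n := by
    rw [← Real.rpow_natCast, ← Real.rpow_natCast, hY, ← Real.rpow_add (by norm_num)]
    refine Real.rpow_le_rpow_of_exponent_le (by norm_num) ?_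
    push_cast
    linarith
  have hkLn : k + 3 * L ≤ 4 ^ n := by
    have : ((k + 3 * L : ℕ) : ℝ) ≤ ((4 ^ n : ℕ) : ℝ) := by
      push_cast; linarith
    exact_mod_cast this
  have hN := card_parts_le_two_pow (s := s) (b := b) (m := m) hn2 hk hkn
    ((Nat.le_add_left _ _).trans hmn) (by rw [hs]; linarith) hkLn
  have hE := exponent_lt hn2 hlam2 hnX hY4 hYs (hM ▸ hkL) (le_trans
    (mul_le_mul_of_nonneg_right (by linarith) (Nat.cast_nonneg L)) hL) hs
  refine natCast_mul_pow_lt_one (by linarith) hN ?_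
  push_cast
  exact hE.trans_le (mul_le_mul_of_nonneg_left hlam3 (by positivity))

/-- A balanced partition uses at least two processors, and at least `k / (b + 1)` of them. -/
theorem IsBalanced.card_occupied {n k b : ℕ} {B : ℝ} (hB : B ≤ b) (hk : 2 ≤ k) (hkn : k ≤ n)
    (hBn : B < (n : ℝ) - n / k) {π : Fin n → Fin k} (hπ : IsBalanced B π) :
    2 ≤ (Finset.univ.image π).card ∧ k ≤ (Finset.univ.image π).card * (b + 1) := by
  have hsum : n = ∑ p ∈ Finset.univ.image π, (Finset.univ.filter fun i => π i = p).card := by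
    conv_lhs => rw [← Fintype.card_fin n, ← Finset.card_univ]
    exact Finset.card_eq_sum_card_image π Finset.univ
  constructor
  · by_contra! hlt
    have hne : (Finset.univ.image π).Nonempty := ⟨_, Finset.mem_image_of_mem π
      (Finset.mem_univ ⟨0, by omega⟩)⟩
    have h1 : (Finset.univ.image π).card = 1 := by
      have := hne.card_pos
      omega
    obtain ⟨p, hp⟩ := Finset.card_eq_one.1 h1
    rw [hp, Finset.sum_singleton] at hsum
    have h2 := (abs_le.1 (hπ p)).2
    rw [← hsum] at h2
    linarith
  · have h1 : n ≤ (Finset.univ.image π).card * (n / k + b) := by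
      calc n = _ := hsum
        _ ≤ (Finset.univ.image π).card • (n / k + b) :=
          Finset.sum_le_card_nsmul _ _ _ fun p _ => IsBalanced.card_le hB hπ p
        _ = _ := smul_eq_mul _ _
    have hq : 1 ≤ n / k := (Nat.one_le_div_iff (by omega)).2 hkn
    have h2 : k * (n / k) ≤ n := Nat.mul_div_le n k
    have h3 : k * (n / k) ≤ (Finset.univ.image π).card * (b + 1) * (n / k) := by
      calc k * (n / k) ≤ (Finset.univ.image π).card * (n / k + b) := h2.trans h1
        _ ≤ (Finset.univ.image π).card * ((b + 1) * (n / k)) := by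
          apply Nat.mul_le_mul_left
          nlinarith
        _ = _ := by ring
    exact Nat.le_of_mul_le_mul_right h3 (by omega)

theorem mainTheorem2 (B : ℝ) :
    ∃ c : ℝ, 0 < c ∧
      ∀ n k m : ℕ, 2 ≤ k → k ≤ n → B < (n : ℝ) - (n : ℝ) / (k : ℝ) →
        ∀ ε : ℝ, (2 : ℝ) ^ (-(n : ℝ)) ≤ ε → ε ≤ 1 / 20 →
          ∃ U : QOp (Fin n), U ∈ qUnitary (Fin n) ∧
            ENNReal.ofReal
                (c * ((4 : ℝ) ^ ((1 - 1 / (k : ℝ)) * (n : ℝ) - (m : ℝ)) *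
                  Real.log (1 / ε) / (n : ℝ))) ≤
              ((approxPartyComplexity B m k U ε : ℕ∞) : ℝ≥0∞) := by
  obtain ⟨b, hb⟩ := exists_nat_ge B
  set M : ℝ := (2 * b + 9) * 4 ^ (b + 2) with hM
  have hMpos : 0 < M := by positivity
  have hb0 : (0 : ℝ) ≤ b := Nat.cast_nonneg b
  -- The factor `b + 1` is lost when the gates only connect the occupied processors, the factor
  -- `96 * M` in the counting argument.
  refine ⟨1 / (96 * (b + 1) * M), by positivity, ?_⟩
  intro n k m hk hkn hBn ε hε hε1
  rw [Real.rpow_neg (by norm_num), Real.rpow_natCast] at hε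
  have hε0 : 0 < ε := lt_of_lt_of_le (by positivity) hε
  set X := (4 : ℝ) ^ ((1 - 1 / (k : ℝ)) * (n : ℝ) - (m : ℝ)) * Real.log (1 / ε) / (n : ℝ)
  have hX0 : 0 ≤ X := by
    have : 0 ≤ Real.log (1 / ε) := Real.log_nonneg (by rw [le_div_iff₀ hε0]; linarith)
    positivity
  rcases lt_or_ge X (32 * M * k) with hlt | hge
  · -- The bound is at most a multiple of `k`, and connecting the occupied processors suffices.
    refine ⟨weightTwoPhase n, weightTwoPhase_mem_qUnitary n,
      ofReal_le_approxPartyComplexity fun V _ hVU π hπ l W hW hWV => ?_⟩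
    have hocc := card_occupied_le_of_near_weightTwoPhase (hVU.trans hε1) hW hWV
    obtain ⟨h2, hkb⟩ := IsBalanced.card_occupied hb hk hkn hBn hπ
    have hkl : k ≤ 2 * l * (b + 1) := hkb.trans (Nat.mul_le_mul_right _ (by omega))
    have hklR : (k : ℝ) ≤ 2 * l * (b + 1) := by exact_mod_cast hkl
    rw [one_div, inv_mul_le_iff₀ (by positivity)]
    nlinarith [mul_le_mul_of_nonneg_left hklR hMpos.le,
      (by positivity : (0 : ℝ) ≤ l * (b + 1) * M)]
  · -- Otherwise the circuits with fewer gates are too few to approximate every unitary.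
    by_contra! hall
    set L := ⌊1 / (96 * (b + 1) * M) * X⌋₊
    have hLle : (L : ℝ) ≤ 1 / (96 * (b + 1) * M) * X := Nat.floor_le (by positivity)
    have hL : 96 * M * L ≤ X := by
      rw [one_div, inv_mul_eq_div, le_div_iff₀ (by positivity)] at hLle
      nlinarith [(by positivity : (0 : ℝ) ≤ M * L * b)]
    have hcover := ((diamCover_cheap (m := m) (L := L) hb (by omega) hk hε).thickening
      (B := (Matrix.unitaryGroup (Fin n → Fin 2) ℂ : Set (QOp (Fin n)))) (ε := ε) ?_)
    · have h1 := DiamCover.one_le_of_unitaryGroup (by linarith) (by linarith) hcover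
      rw [Fintype.card_fun, Fintype.card_fin, Fintype.card_fin, pow_right_comm (2 : ℕ) n 2,
        show (2 : ℕ) ^ 2 = 4 by norm_num, show ε + 2 * ε = 3 * ε by ring] at h1
      exact absurd h1 (not_le.2 (card_parts_mul_lt_one hk hkn hε hε1 hge hL))
    · intro U hU
      have hU' := hall U hU
      by_contra! hno
      refine absurd (ofReal_le_approxPartyComplexity fun V hV hVU π hπ l W hW hWV => ?_)
        (not_le.2 hU')
      by_contra! hl
      refine absurd hVU (not_le.2 ?_)
      rw [norm_sub_rev, ← dist_eq_norm]
      exact hno V ⟨π, hπ, l, Nat.le_floor hl.le, W, hW, hWV⟩
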